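/- Every finite simple outerplanar graph is $(\frac{5}{2},4)^*$-colorable. That is, let $G$ be a finite simple graph that has a planar drawing (vertices are distinct points of the plane, edges are simple arcs joining their ends and containing no other vertices, and different edges meet at most in a common end) in which every vertex lies on the boundary of the outer face. Then there is a map $f:V(G)\to\{0,1,2,3,4\}$ such that $f(u)\neq f(v)$ for all adjacent vertices $u,v$, and such that every vertex $u$ has at most $4$ neighbours $v$ with $|f(u)-f(v)|_5=1$, where $|i-j|_5=\min\{|i-j|,\,5-|i-j|\}$ denotes the circular distance. -/

import Mathlib

/-- The Euclidean plane. -/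
abbrev Plane : Type := EuclideanSpace ℝ (Fin 2)

/-- A planar drawing of a simple graph: the vertices are distinct points of the plane, each edge is
a simple (continuous, non-self-intersecting) arc joining its two ends and passing through no other
vertex, and two different edges meet at most in a common end. -/
structure PlanarDrawing {V : Type*} (G : SimpleGraph V) where
  /-- The point representing a vertex. -/
  pt : V → Plane
  /-- The set of points of the arc representing an edge. -/
  arc : G.edgeSet → Set Plane
  pt_injective : Function.Injective pt
  arc_isArc : ∀ (u v : V) (h : G.Adj u v),
    ∃ γ : Path (pt u) (pt v), Function.Injective γ ∧ Set.range γ = arc ⟨s(u, v), h⟩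
  mem_of_pt_mem_arc : ∀ (w : V) (e : G.edgeSet), pt w ∈ arc e → w ∈ (e : Sym2 V)
  arc_inter : ∀ e f : G.edgeSet, e ≠ f → ∀ x ∈ arc e ∩ arc f,
    ∃ w : V, w ∈ (e : Sym2 V) ∧ w ∈ (f : Sym2 V) ∧ pt w = x

namespace PlanarDrawing

variable {V : Type*} {G : SimpleGraph V}

/-- The set of all points of the plane used by the drawing. -/
def support (D : PlanarDrawing G) : Set Plane :=
  Set.range D.pt ∪ ⋃ e, D.arc e

/-- The outer face of the drawing. The faces are the connected components of the complement of the
drawing; for a finite graph exactly one of them is unbounded, and it is the outer face. -/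
def outerFace (D : PlanarDrawing G) : Set Plane :=
  {x | x ∈ D.supportᶜ ∧ ¬ Bornology.IsBounded (connectedComponentIn D.supportᶜ x)}

end PlanarDrawing

/-- A graph is outerplanar if it has a planar drawing in which every vertex lies on the boundary of
the outer face. -/
def IsOuterplanar {V : Type*} (G : SimpleGraph V) : Prop :=
  ∃ D : PlanarDrawing G, ∀ v : V, D.pt v ∈ frontier D.outerFace

/-- The circular distance `min {|i - j|, k - |i - j|}` of two colours in `{0, 1, ..., k - 1}`. -/
def circDist {k : ℕ} (i j : Fin k) : ℕ :=
  min (Nat.dist i j) (k - Nat.dist i j)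

/-- `f` is a `t`-relaxed `q`-distant circular `k`-colouring of `G`, i.e. a `(k/q, t)^*`-colouring:
adjacent vertices receive different colours, and every vertex has at most `t` neighbours whose
colour is at circular distance less than `q` from its own. -/
def IsRelaxedCircularColoring {V : Type*} (G : SimpleGraph V) (k q t : ℕ) (f : V → Fin k) : Prop :=
  (∀ u v : V, G.Adj u v → f u ≠ f v) ∧
    ∀ u : V, {v : V | G.Adj u v ∧ circDist (f u) (f v) < q}.encard ≤ t

/-- `G` is `(k/q, t)^*`-colourable. -/
def IsRelaxedCircularColorable {V : Type*} (G : SimpleGraph V) (k q t : ℕ) : Prop :=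
  ∃ f : V → Fin k, IsRelaxedCircularColoring G k q t f

/-! Outerplanarity is used only through `NoTripleLinkage`. An apex in the outer face can be joined
to every vertex, so four vertices linked in all three ways would, with the apex, map $K_5$ to the
plane with independent edges disjoint. A parity count of winding numbers excludes this
(`not_disjoint_independent_paths`).

Now layer each component by distance from a root. Linkages through shallower and through deeper
layers show that `layerGraph` is a forest, that a vertex has at most two neighbours in its own
layer, that the parents of a lobe number at most two and are then adjacent in `layerGraph`, and that
at most one vertex of a lobe has two parents.

Colour downwards so that `layerGraph` neighbours differ by $\pm1$ and parent and child by $\pm2$.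
Some colour $m$ is at distance 2 from all parents of a lobe. One class of a 2-colouring of the lobe,
containing its two-parent vertex if there is one, receives $m$; every other vertex receives the
reflection of $m$ in the colour of its parent. Only neighbours in the same layer are then at
distance 1, which gives the bound 2 in place of 4. -/

/-! ### Winding of planar paths and the non-planarity of `K₅` -/

/-- `θ` is a continuous choice of argument along `f`. -/
def IsAngle {A : Type*} [TopologicalSpace A] (f : A → ℂ) (θ : A → ℝ) : Prop :=
  Continuous θ ∧ ∀ a, f a = ‖f a‖ * Complex.exp (θ a * Complex.I)

theorem exists_isAngle {A : Type*} [TopologicalSpace A] [SimplyConnectedSpace A]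
    [LocallyPathConnectedSpace A] (f : A → ℂ) (hf : Continuous f) (h0 : ∀ a, f a ≠ 0) :
    ∃ θ : A → ℝ, IsAngle f θ := by
  let g : C(A, Circle) := ⟨fun a => ⟨f a / ‖f a‖, by
    simp [Submonoid.unitSphere, h0 a]⟩, by
    refine Continuous.subtype_mk ?_ _
    refine hf.div (by fun_prop) fun a => by simp [h0 a]⟩
  obtain ⟨a₀⟩ : Nonempty A := inferInstance
  obtain ⟨F, ⟨-, hF⟩, -⟩ := Circle.isCoveringMap_exp.existsUnique_continuousMap_lifts g a₀
    (Complex.arg (g a₀)) (Circle.exp_arg _)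
  refine ⟨F, F.continuous, fun a => ?_⟩
  have h := congrArg (Subtype.val) (congrFun hF a)
  change Complex.exp (F a * Complex.I) = f a / ‖f a‖ at h
  have h2 : (‖f a‖ : ℂ) ≠ 0 := by simp [h0 a]
  rw [h]
  field_simp

theorem isAngle_unique {f : ℝ → ℂ} {θ θ' : ℝ → ℝ} (h0 : ∀ a, f a ≠ 0) (h : IsAngle f θ)
    (h' : IsAngle f θ') (s t : ℝ) : θ t - θ s = θ' t - θ' s := by
  have key : ∀ a, Complex.exp (θ a * Complex.I) = Complex.exp (θ' a * Complex.I) := fun a => by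
    have h2 : (‖f a‖ : ℂ) ≠ 0 := by simp [h0 a]
    exact mul_left_cancel₀ h2 ((h.2 a).symm.trans (h'.2 a))
  have hs : Circle.exp (θ s - θ' s) = 1 := by
    rw [Circle.exp_sub]
    have : Circle.exp (θ s) = Circle.exp (θ' s) := Subtype.ext (key s)
    rw [this, div_self']
  have := Circle.isCoveringMap_exp.eq_of_comp_eq (g₁ := θ)
    (g₂ := fun a => θ' a + (θ s - θ' s)) h.1 (h'.1.add continuous_const) (by
      funext a
      simp only [Function.comp, Circle.exp_add, hs, mul_one]
      exact Subtype.ext (key a)) s (by ring)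
  have := congrFun this t
  linarith

theorem exists_int_angle {z : ℂ} (hz : z ≠ 0) {θ : ℝ} (h : z = ‖z‖ * Complex.exp (θ * Complex.I)) :
    ∃ m : ℤ, θ = z.arg + 2 * Real.pi * m := by
  have h2 : (‖z‖ : ℂ) ≠ 0 := by simp [hz]
  have h1 : Complex.exp (θ * Complex.I) = Complex.exp (z.arg * Complex.I) :=
    mul_left_cancel₀ h2 (h.symm.trans (Complex.norm_mul_exp_arg_mul_I z).symm)
  obtain ⟨m, hm⟩ := Complex.exp_eq_exp_iff_exists_int.mp h1
  refine ⟨m, ?_⟩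
  have := congrArg Complex.im hm
  simp at this
  linarith

theorem exists_int_arg_sub (x y : ℂ) (h : x ≠ y) :
    ∃ k : ℤ, (x - y).arg - (y - x).arg = Real.pi * (2 * k - 1) := by
  have hz : x - y ≠ 0 := sub_ne_zero.mpr h
  obtain ⟨m, hm⟩ := exists_int_angle (θ := (y - x).arg + Real.pi) hz (by
    push_cast
    rw [add_mul, Complex.exp_add, Complex.exp_pi_mul_I, norm_sub_rev, ← mul_assoc,
      Complex.norm_mul_exp_arg_mul_I]
    ring)
  refine ⟨1 - m, ?_⟩
  push_cast
  linarith

/-- The number of half-turns by which the arguments of `x - y` and `y - x` differ. -/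
noncomputable def halfTurn (x y : ℂ) : ℤ :=
  Classical.epsilon fun k : ℤ => (x - y).arg - (y - x).arg = Real.pi * (2 * k - 1)

theorem halfTurn_spec {x y : ℂ} (h : x ≠ y) :
    (x - y).arg - (y - x).arg = Real.pi * (2 * halfTurn x y - 1) :=
  Classical.epsilon_spec (exists_int_arg_sub x y h)

/-- The 1 here is the only source of oddness in the parity count for $K_5$. -/
theorem halfTurn_swap {x y : ℂ} (h : x ≠ y) : halfTurn y x = 1 - halfTurn x y := by
  have h1 := halfTurn_spec h
  have h2 := halfTurn_spec h.symm
  have : Real.pi * (2 * (halfTurn y x + halfTurn x y - 1)) = 0 := by linarith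
  have h3 : (2 * ((halfTurn y x : ℝ) + halfTurn x y - 1)) = 0 := by
    simpa [Real.pi_ne_zero] using this
  have : ((halfTurn y x + halfTurn x y - 1 : ℤ) : ℝ) = 0 := by push_cast; linarith
  have := Int.cast_eq_zero.mp this
  omega

/-- The number of full turns made by a path around a point, relative to principal arguments. -/
noncomputable def turns {a b : ℂ} (γ : Path a b) (q : ℂ) : ℤ :=
  Classical.epsilon fun n : ℤ => ∀ θ : ℝ → ℝ, IsAngle (fun t => γ.extend t - q) θ →
    θ 1 - θ 0 = (b - q).arg - (a - q).arg + 2 * Real.pi * n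

theorem extend_mem_range {a b : ℂ} (γ : Path a b) (t : ℝ) : γ.extend t ∈ Set.range γ := by
  simp [Path.extend, Set.IccExtend]

theorem turns_spec {a b : ℂ} (γ : Path a b) {q : ℂ} (hq : q ∉ Set.range γ) {θ : ℝ → ℝ}
    (hθ : IsAngle (fun t => γ.extend t - q) θ) :
    θ 1 - θ 0 = (b - q).arg - (a - q).arg + 2 * Real.pi * turns γ q := by
  have h0 : ∀ t, γ.extend t - q ≠ 0 := fun t ht =>
    hq (sub_eq_zero.mp ht ▸ extend_mem_range γ t)
  refine Classical.epsilon_spec (p := fun n : ℤ => ∀ θ : ℝ → ℝ,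
    IsAngle (fun t => γ.extend t - q) θ →
    θ 1 - θ 0 = (b - q).arg - (a - q).arg + 2 * Real.pi * n) ?_ θ hθ
  obtain ⟨m, hm⟩ := exists_int_angle (h0 1) (hθ.2 1)
  obtain ⟨k, hk⟩ := exists_int_angle (h0 0) (hθ.2 0)
  refine ⟨m - k, fun θ' hθ' => ?_⟩
  rw [isAngle_unique h0 hθ' hθ, hm, hk]
  simp only [Path.extend_one, Path.extend_zero]
  push_cast
  ring

/-- The relation between the windings of two disjoint paths around each other's ends. -/
theorem turns_relation {a b c d : ℂ} (γ : Path a b) (δ : Path c d)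
    (h : Disjoint (Set.range γ) (Set.range δ)) :
    halfTurn b c - halfTurn a c - halfTurn b d + halfTurn a d
      + turns γ c + turns δ b - turns γ d - turns δ a = 0 := by
  have hne : ∀ s t, γ.extend s - δ.extend t ≠ 0 := fun s t e =>
    Set.disjoint_left.mp h (extend_mem_range γ s) (sub_eq_zero.mp e ▸ extend_mem_range δ t)
  -- One continuous argument of $\gamma(s)-\delta(t)$ on the whole plane of parameters: its
  -- increments around the unit square sum to zero, and each side is the winding of one path around
  -- an end of the other.
  obtain ⟨Θ, hΘ⟩ := exists_isAngle (A := ℝ × ℝ) (fun x => γ.extend x.1 - δ.extend x.2)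
    (by fun_prop) (fun x => hne _ _)
  have hγ : ∀ t, δ.extend t ∉ Set.range γ := fun t ht =>
    Set.disjoint_left.mp h ht (extend_mem_range δ t)
  have hδ : ∀ t, γ.extend t ∉ Set.range δ := fun t ht =>
    Set.disjoint_left.mp h (extend_mem_range γ t) ht
  have e1 : ∀ t, IsAngle (fun s => γ.extend s - δ.extend t) (fun s => Θ (s, t)) := fun t =>
    ⟨hΘ.1.comp (by fun_prop), fun s => hΘ.2 (s, t)⟩
  have e2 : ∀ s, IsAngle (fun t => δ.extend t - γ.extend s) (fun t => Θ (s, t) + Real.pi) :=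
    fun s => ⟨(hΘ.1.comp (by fun_prop)).add continuous_const, fun t => by
      have := hΘ.2 (s, t)
      simp only at this ⊢
      push_cast
      rw [add_mul, Complex.exp_add, Complex.exp_pi_mul_I, norm_sub_rev, ← mul_assoc, ← this]
      ring⟩
  have f1 := turns_spec γ (hγ 0) (e1 0)
  have f2 := turns_spec γ (hγ 1) (e1 1)
  have f3 := turns_spec δ (hδ 0) (e2 0)
  have f4 := turns_spec δ (hδ 1) (e2 1)
  have ne : ∀ s t, γ.extend s ≠ δ.extend t := fun s t => sub_ne_zero.mp (hne s t)
  have g1 := halfTurn_spec (ne 1 0)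
  have g2 := halfTurn_spec (ne 0 0)
  have g3 := halfTurn_spec (ne 1 1)
  have g4 := halfTurn_spec (ne 0 1)
  simp only [Path.extend_one, Path.extend_zero] at f1 f2 f3 f4 g1 g2 g3 g4
  have key : Real.pi * (2 * ((halfTurn b c - halfTurn a c - halfTurn b d + halfTurn a d
      + turns γ c + turns δ b - turns γ d - turns δ a : ℤ) : ℝ)) = 0 := by
    push_cast
    linarith
  have : ((halfTurn b c - halfTurn a c - halfTurn b d + halfTurn a d
      + turns γ c + turns δ b - turns γ d - turns δ a : ℤ) : ℝ) = 0 := by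
    simpa [Real.pi_ne_zero] using key
  exact_mod_cast this

/-- `K₅` cannot be mapped to the plane with independent edges having disjoint images. -/
theorem not_disjoint_independent_paths {p₀ p₁ p₂ p₃ p₄ : ℂ}
    (g₀₁ : Path p₀ p₁) (g₀₂ : Path p₀ p₂) (g₀₃ : Path p₀ p₃) (g₀₄ : Path p₀ p₄)
    (g₁₂ : Path p₁ p₂) (g₁₃ : Path p₁ p₃) (g₁₄ : Path p₁ p₄)
    (g₂₃ : Path p₂ p₃) (g₂₄ : Path p₂ p₄) (g₃₄ : Path p₃ p₄)
    (h₁ : Disjoint (Set.range g₀₁) (Set.range g₂₃))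
    (h₂ : Disjoint (Set.range g₀₁) (Set.range g₂₄))
    (h₃ : Disjoint (Set.range g₀₁) (Set.range g₃₄))
    (h₄ : Disjoint (Set.range g₀₂) (Set.range g₁₃))
    (h₅ : Disjoint (Set.range g₀₂) (Set.range g₁₄))
    (h₆ : Disjoint (Set.range g₀₂) (Set.range g₃₄))
    (h₇ : Disjoint (Set.range g₀₃) (Set.range g₁₂))
    (h₈ : Disjoint (Set.range g₀₃) (Set.range g₁₄))
    (h₉ : Disjoint (Set.range g₀₃) (Set.range g₂₄))
    (h₁₀ : Disjoint (Set.range g₀₄) (Set.range g₁₂))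
    (h₁₁ : Disjoint (Set.range g₀₄) (Set.range g₁₃))
    (h₁₂ : Disjoint (Set.range g₀₄) (Set.range g₂₃))
    (h₁₃ : Disjoint (Set.range g₁₂) (Set.range g₃₄))
    (h₁₄ : Disjoint (Set.range g₁₃) (Set.range g₂₄))
    (h₁₅ : Disjoint (Set.range g₁₄) (Set.range g₂₃)) : False := by
  have ne : ∀ {a b c d : ℂ} (γ : Path a b) (δ : Path c d),
      Disjoint (Set.range γ) (Set.range δ) → b ≠ c := fun γ δ h e =>
    Set.disjoint_left.mp h ⟨1, γ.target⟩ ⟨0, by rw [δ.source, e]⟩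
  have r₁ := turns_relation _ _ h₁
  have r₂ := turns_relation _ _ h₂
  have r₃ := turns_relation _ _ h₃
  have r₄ := turns_relation _ _ h₄
  have r₅ := turns_relation _ _ h₅
  have r₆ := turns_relation _ _ h₆
  have r₇ := turns_relation _ _ h₇
  have r₈ := turns_relation _ _ h₈
  have r₉ := turns_relation _ _ h₉
  have r₁₀ := turns_relation _ _ h₁₀
  have r₁₁ := turns_relation _ _ h₁₁
  have r₁₂ := turns_relation _ _ h₁₂
  have r₁₃ := turns_relation _ _ h₁₃
  have r₁₄ := turns_relation _ _ h₁₄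
  have r₁₅ := turns_relation _ _ h₁₅
  have t₁ := halfTurn_swap (ne g₀₂ g₁₃ h₄)
  have t₂ := halfTurn_swap (ne g₀₃ g₁₂ h₇)
  have t₃ := halfTurn_swap (ne g₀₄ g₁₂ h₁₀)
  have t₄ := halfTurn_swap (ne g₀₃ g₂₄ h₉)
  have t₅ := halfTurn_swap (ne g₀₄ g₂₃ h₁₂)
  have t₆ := halfTurn_swap (x := p₃) (y := p₄) fun e =>
    Set.disjoint_left.mp h₁₄ ⟨1, g₁₃.target⟩ ⟨1, by rw [g₂₄.target, e]⟩
  -- Add the fifteen relations modulo 2. Each pair of an edge and a vertex off it gives two `turns`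
  -- terms, and each pair of vertices gives six `halfTurn` terms, so only the swaps count. With
  -- indices increasing along edges, nested pairs need two swaps, separated pairs none and
  -- interleaved pairs one; there are five interleaved pairs, so the sum is odd.
  omega

/-! ### Linkages in outerplanar graphs -/

namespace PlanarDrawing

variable {V : Type*} {G : SimpleGraph V}

/-- The part of a drawing that represents the subgraph induced on `A`. -/
def inducedSupport (D : PlanarDrawing G) (A : Set V) : Set Plane :=
  D.pt '' A ∪ ⋃ (e : G.edgeSet) (_ : ∀ w ∈ (e : Sym2 V), w ∈ A), D.arc e

theorem isCompact_arc (D : PlanarDrawing G) (e : G.edgeSet) : IsCompact (D.arc e) := by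
  obtain ⟨e, he⟩ := e
  induction e using Sym2.ind with
  | _ u v =>
    obtain ⟨γ, -, h⟩ := D.arc_isArc u v he
    rw [← h]
    exact isCompact_range γ.continuous

theorem isCompact_inducedSupport [Finite V] (D : PlanarDrawing G) (A : Set V) :
    IsCompact (D.inducedSupport A) := by
  refine ((Set.toFinite A).image _).isCompact.union ?_
  exact isCompact_iUnion fun e => isCompact_iUnion fun _ => D.isCompact_arc e

theorem inducedSupport_subset_support (D : PlanarDrawing G) (A : Set V) :
    D.inducedSupport A ⊆ D.support := by
  rintro x (⟨v, -, rfl⟩ | hx)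
  · exact Or.inl ⟨v, rfl⟩
  · simp only [Set.mem_iUnion] at hx
    obtain ⟨e, -, hx⟩ := hx
    exact Or.inr (Set.mem_iUnion.mpr ⟨e, hx⟩)

theorem inducedSupport_univ (D : PlanarDrawing G) : D.inducedSupport Set.univ = D.support := by
  simp [inducedSupport, support]

theorem inducedSupport_mono (D : PlanarDrawing G) {A B : Set V} (h : A ⊆ B) :
    D.inducedSupport A ⊆ D.inducedSupport B := by
  rintro x (⟨v, hv, rfl⟩ | hx)
  · exact Or.inl ⟨v, h hv, rfl⟩
  · simp only [Set.mem_iUnion] at hx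
    obtain ⟨e, he, hx⟩ := hx
    refine Or.inr ?_
    simp only [Set.mem_iUnion]
    exact ⟨e, fun w hw => h (he w hw), hx⟩

theorem disjoint_inducedSupport (D : PlanarDrawing G) {A B : Set V} (h : Disjoint A B) :
    Disjoint (D.inducedSupport A) (D.inducedSupport B) := by
  rw [Set.disjoint_left] at h ⊢
  have ends : ∀ e : G.edgeSet, ∃ w, w ∈ (e : Sym2 V) := fun e => by
    obtain ⟨e, he⟩ := e
    induction e using Sym2.ind with
    | _ u v => exact ⟨u, Sym2.mem_mk_left u v⟩
  rintro x (⟨v, hv, rfl⟩ | hx) (⟨w, hw, hwx⟩ | hy)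
  · exact h hv (D.pt_injective hwx ▸ hw)
  · simp only [Set.mem_iUnion] at hy
    obtain ⟨e, he, hy⟩ := hy
    exact h hv (he v (D.mem_of_pt_mem_arc v e hy))
  · simp only [Set.mem_iUnion] at hx
    obtain ⟨e, he, hx⟩ := hx
    rw [← hwx] at hx
    exact h (he w (D.mem_of_pt_mem_arc w e hx)) hw
  · simp only [Set.mem_iUnion] at hx hy
    obtain ⟨e, he, hx⟩ := hx
    obtain ⟨f, hf, hy⟩ := hy
    by_cases hef : e = f
    · obtain ⟨w, hw⟩ := ends e
      exact h (he w hw) (hf w (hef ▸ hw))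
    · obtain ⟨w, hwe, hwf, -⟩ := D.arc_inter e f hef x ⟨hx, hy⟩
      exact h (he w hwe) (hf w hwf)

theorem joinedIn_inducedSupport (D : PlanarDrawing G) {a b : V} (p : G.Walk a b) {A : Set V}
    (h : ∀ x ∈ p.support, x ∈ A) : JoinedIn (D.inducedSupport A) (D.pt a) (D.pt b) := by
  induction p with
  | nil => exact JoinedIn.refl (Or.inl ⟨_, h _ (by simp), rfl⟩)
  | @cons u v w e p ih =>
    refine JoinedIn.trans ?_ (ih fun x hx => h x (by simp [hx]))
    obtain ⟨γ, -, hγ⟩ := D.arc_isArc u v e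
    refine ⟨γ, fun t => Or.inr ?_⟩
    simp only [Set.mem_iUnion]
    refine ⟨⟨s(u, v), e⟩, ?_, hγ ▸ ⟨t, rfl⟩⟩
    intro x hx
    rcases Sym2.mem_iff.mp hx with rfl | rfl
    · exact h _ (by simp)
    · exact h _ (by simp)

/-- Some point off the drawing can be joined to every vertex of the outer face by a path that
meets the drawing only in edges at that vertex. -/
theorem exists_apex [Finite V] (D : PlanarDrawing G)
    (hD : ∀ v : V, D.pt v ∈ frontier D.outerFace) :
    ∃ q : Plane, ∀ v, JoinedIn (D.inducedSupport {v}ᶜ)ᶜ (D.pt v) q := by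
  have hc : IsCompact D.support := D.inducedSupport_univ ▸ D.isCompact_inducedSupport _
  obtain ⟨R, hR0, hR⟩ := hc.isBounded.subset_ball_lt 0 0
  have hrank : 1 < Module.rank ℝ Plane := by
    rw [← Module.finrank_eq_rank]
    simp
  have hS := isPathConnected_sphere hrank (0 : Plane) hR0.le
  obtain ⟨q, hq⟩ := hS.nonempty
  refine ⟨q, fun v => ?_⟩
  have hK : IsClosed (D.inducedSupport {v}ᶜ) := (D.isCompact_inducedSupport _).isClosed
  have hsub := D.inducedSupport_subset_support {v}ᶜ
  have hv : D.pt v ∉ D.inducedSupport {v}ᶜ := by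
    refine Set.disjoint_left.mp (D.disjoint_inducedSupport (A := {v}) ?_) (Or.inl ⟨v, rfl, rfl⟩)
    exact disjoint_compl_right
  -- Near `D.pt v` only edges at `v` can be met, so the outer face is reached inside this ball. The
  -- path then runs within the face past radius `R`, radially back to the sphere, and along it to
  -- `q`.
  obtain ⟨ε, hε, hball⟩ := Metric.isOpen_iff.mp hK.isOpen_compl _ hv
  obtain ⟨x, hx, hxv⟩ := Metric.mem_closure_iff.mp (frontier_subset_closure (hD v)) ε hε
  have j1 : JoinedIn (D.inducedSupport {v}ᶜ)ᶜ (D.pt v) x := by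
    refine (((convex_ball (D.pt v) ε).isPathConnected ⟨_, Metric.mem_ball_self hε⟩).joinedIn _
      (Metric.mem_ball_self hε) _ ?_).mono hball
    rwa [Metric.mem_ball, dist_comm]
  have hopen : IsOpen (connectedComponentIn D.supportᶜ x) :=
    hc.isClosed.isOpen_compl.connectedComponentIn
  have hpc : IsPathConnected (connectedComponentIn D.supportᶜ x) :=
    hopen.isConnected_iff_isPathConnected.mp (isConnected_connectedComponentIn_iff.mpr hx.1)
  obtain ⟨y, hy, hyR⟩ : ∃ y ∈ connectedComponentIn D.supportᶜ x, R < ‖y‖ := by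
    by_contra! hcon
    exact hx.2 (isBounded_iff_forall_norm_le.mpr ⟨R, hcon⟩)
  have j2 : JoinedIn (D.inducedSupport {v}ᶜ)ᶜ x y :=
    (hpc.joinedIn _ (mem_connectedComponentIn hx.1) _ hy).mono
      ((connectedComponentIn_subset _ _).trans (Set.compl_subset_compl.mpr hsub))
  have hout : ∀ z : Plane, R ≤ ‖z‖ → z ∈ (D.inducedSupport {v}ᶜ)ᶜ := fun z hz hzs => by
    have := hR (hsub hzs)
    rw [mem_ball_zero_iff] at this
    linarith
  have hy0 : 0 < ‖y‖ := hR0.trans hyR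
  have j3 : JoinedIn (D.inducedSupport {v}ᶜ)ᶜ y ((R / ‖y‖) • y) := by
    refine JoinedIn.ofLine (f := fun t : ℝ => (1 + t * (R / ‖y‖ - 1)) • y)
      (by fun_prop) (by simp) (by simp) ?_
    rintro _ ⟨t, ht, rfl⟩
    refine hout _ ?_
    have h1 : R / ‖y‖ ≤ 1 + t * (R / ‖y‖ - 1) := by
      have : R / ‖y‖ ≤ 1 := (div_le_one hy0).mpr hyR.le
      nlinarith [ht.1, ht.2]
    have h2 : 0 < R / ‖y‖ := by positivity
    rw [norm_smul, Real.norm_of_nonneg (h2.le.trans h1)]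
    calc R = R / ‖y‖ * ‖y‖ := by field_simp
      _ ≤ _ := by gcongr
  have j4 : JoinedIn (D.inducedSupport {v}ᶜ)ᶜ ((R / ‖y‖) • y) q := by
    refine (hS.joinedIn _ ?_ _ hq).mono fun z hz => hout z ?_
    · rw [mem_sphere_zero_iff_norm, norm_smul, Real.norm_of_nonneg (by positivity)]
      field_simp
    · rw [mem_sphere_zero_iff_norm] at hz
      exact hz.ge
  exact ((j1.trans j2).trans j3).trans j4

end PlanarDrawing

/-- The identification of the Euclidean plane with the complex plane. -/
noncomputable def planeToComplex (x : Plane) : ℂ := ⟨x 0, x 1⟩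

theorem continuous_planeToComplex : Continuous planeToComplex := by
  have : planeToComplex = fun x => (x 0 : ℂ) + (x 1 : ℂ) * Complex.I := by
    funext x
    apply Complex.ext <;> simp [planeToComplex]
  rw [this]
  fun_prop

theorem planeToComplex_injective : Function.Injective planeToComplex := fun x y h => by
  ext i
  fin_cases i
  · exact congrArg Complex.re h
  · exact congrArg Complex.im h

/-- No four vertices are linked in all three ways: a graph has the property if there are no
vertices `a`, `b`, `c`, `d` for which each of the three pairings can be realised by two disjoint
walks. -/
def NoTripleLinkage {V : Type*} (G : SimpleGraph V) : Prop :=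
  ∀ (a b c d : V) (p₁ : G.Walk a b) (q₁ : G.Walk c d) (p₂ : G.Walk a c) (q₂ : G.Walk b d)
    (p₃ : G.Walk a d) (q₃ : G.Walk b c), p₁.support.Disjoint q₁.support →
    p₂.support.Disjoint q₂.support → p₃.support.Disjoint q₃.support → False

/-- The apex `q` is the fifth vertex of $K_5$. Its path to `v` may cross edges at `v`, but it avoids
every walk that misses `v`, and only independent pairs matter. -/
theorem IsOuterplanar.noTripleLinkage {V : Type*} [Finite V] {G : SimpleGraph V}
    (hG : IsOuterplanar G) : NoTripleLinkage G := by
  obtain ⟨D, hD⟩ := hG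
  obtain ⟨q, hq⟩ := D.exists_apex hD
  intro a b c d p₁ q₁ p₂ q₂ p₃ q₃ d₁ d₂ d₃
  have walkPath : ∀ {x y : V} (p : G.Walk x y), ∃ γ : Path (D.pt x) (D.pt y),
      ∀ t, γ t ∈ D.inducedSupport {z | z ∈ p.support} := fun p =>
    D.joinedIn_inducedSupport p fun _ h => h
  have dw : ∀ {x y z w : V} {p : G.Walk x y} {r : G.Walk z w} (γ : Path (D.pt x) (D.pt y))
      (δ : Path (D.pt z) (D.pt w)), (∀ t, γ t ∈ D.inducedSupport {z | z ∈ p.support}) →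
      (∀ t, δ t ∈ D.inducedSupport {z | z ∈ r.support}) → p.support.Disjoint r.support →
      Disjoint (Set.range (γ.map continuous_planeToComplex))
        (Set.range (δ.map continuous_planeToComplex)) := fun γ δ hγ hδ h => by
    rw [Set.disjoint_left]
    rintro _ ⟨s, rfl⟩ ⟨t, ht⟩
    have := planeToComplex_injective ht
    refine Set.disjoint_left.mp (D.disjoint_inducedSupport ?_) (hγ s) (this ▸ hδ t)
    rw [Set.disjoint_left]
    exact fun x hx hx' => h hx hx'
  have da : ∀ {v x y : V} {p : G.Walk x y} (γ : Path (D.pt v) q)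
      (δ : Path (D.pt x) (D.pt y)), (∀ t, γ t ∈ (D.inducedSupport {v}ᶜ)ᶜ) →
      (∀ t, δ t ∈ D.inducedSupport {z | z ∈ p.support}) → v ∉ p.support →
      Disjoint (Set.range (γ.map continuous_planeToComplex))
        (Set.range (δ.map continuous_planeToComplex)) := fun {v} {x} {y} {p} γ δ hγ hδ h => by
    rw [Set.disjoint_left]
    rintro _ ⟨s, rfl⟩ ⟨t, ht⟩
    have := planeToComplex_injective ht
    refine hγ s (this ▸ D.inducedSupport_mono ?_ (hδ t))
    rintro z hz rfl
    exact h hz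
  obtain ⟨g₀₁, h₀₁⟩ := walkPath p₁
  obtain ⟨g₂₃, h₂₃⟩ := walkPath q₁
  obtain ⟨g₀₂, h₀₂⟩ := walkPath p₂
  obtain ⟨g₁₃, h₁₃⟩ := walkPath q₂
  obtain ⟨g₀₃, h₀₃⟩ := walkPath p₃
  obtain ⟨g₁₂, h₁₂⟩ := walkPath q₃
  obtain ⟨g₀, h₀⟩ := hq a
  obtain ⟨g₁, h₁⟩ := hq b
  obtain ⟨g₂, h₂⟩ := hq c
  obtain ⟨g₃, h₃⟩ := hq d
  exact not_disjoint_independent_paths _ _ _ (g₀.map continuous_planeToComplex) _ _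
    (g₁.map continuous_planeToComplex) _ (g₂.map continuous_planeToComplex)
    (g₃.map continuous_planeToComplex)
    (dw g₀₁ g₂₃ h₀₁ h₂₃ d₁)
    (da g₂ g₀₁ h₂ h₀₁ fun h => d₁ h q₁.start_mem_support).symm
    (da g₃ g₀₁ h₃ h₀₁ fun h => d₁ h q₁.end_mem_support).symm
    (dw g₀₂ g₁₃ h₀₂ h₁₃ d₂)
    (da g₁ g₀₂ h₁ h₀₂ fun h => d₂ h q₂.start_mem_support).symm
    (da g₃ g₀₂ h₃ h₀₂ fun h => d₂ h q₂.end_mem_support).symm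
    (dw g₀₃ g₁₂ h₀₃ h₁₂ d₃)
    (da g₁ g₀₃ h₁ h₀₃ fun h => d₃ h q₃.start_mem_support).symm
    (da g₂ g₀₃ h₂ h₀₃ fun h => d₃ h q₃.end_mem_support).symm
    (da g₀ g₁₂ h₀ h₁₂ fun h => d₃ p₃.start_mem_support h)
    (da g₀ g₁₃ h₀ h₁₃ fun h => d₂ p₂.start_mem_support h)
    (da g₀ g₂₃ h₀ h₂₃ fun h => d₁ p₁.start_mem_support h)
    (da g₃ g₁₂ h₃ h₁₂ fun h => d₃ p₃.end_mem_support h).symm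
    (da g₂ g₁₃ h₂ h₁₃ fun h => d₂ p₂.end_mem_support h).symm
    (da g₁ g₂₃ h₁ h₂₃ fun h => d₁ p₁.end_mem_support h)

/-! ### Layered colouring of graphs without triple linkages -/

namespace SimpleGraph

variable {V : Type*} (G : SimpleGraph V)

/-- `x` and `y` are joined by a walk inside `S`. -/
def WalkIn (S : Set V) (x y : V) : Prop := ∃ p : G.Walk x y, ∀ z ∈ p.support, z ∈ S

variable {G}

theorem WalkIn.mono {S T : Set V} {x y : V} (h : G.WalkIn S x y) (hST : ∀ z ∈ S, z ∈ T) :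
    G.WalkIn T x y :=
  let ⟨p, hp⟩ := h
  ⟨p, fun z hz => hST z (hp z hz)⟩

theorem WalkIn.symm {S : Set V} {x y : V} (h : G.WalkIn S x y) : G.WalkIn S y x :=
  let ⟨p, hp⟩ := h
  ⟨p.reverse, fun z hz => hp z (by simpa using hz)⟩

theorem WalkIn.trans {S : Set V} {x y z : V} (h : G.WalkIn S x y) (h' : G.WalkIn S y z) :
    G.WalkIn S x z :=
  let ⟨p, hp⟩ := h
  let ⟨q, hq⟩ := h'
  ⟨p.append q, fun w hw => by
    rcases Walk.mem_support_append_iff _ _ |>.mp hw with h | h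
    exacts [hp w h, hq w h]⟩

theorem WalkIn.refl {S : Set V} {x : V} (h : x ∈ S) : G.WalkIn S x x := ⟨.nil, by simpa⟩

theorem WalkIn.of_adj {S : Set V} {x y : V} (h : G.Adj x y) (hx : x ∈ S) (hy : y ∈ S) :
    G.WalkIn S x y := ⟨.cons h .nil, by simp [hx, hy]⟩

theorem WalkIn.reachable {S : Set V} {x y : V} (h : G.WalkIn S x y) : G.Reachable x y :=
  ⟨h.choose⟩

end SimpleGraph

open SimpleGraph

theorem NoTripleLinkage.elim {V : Type*} {G : SimpleGraph V} (hL : NoTripleLinkage G)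
    {a b c d : V} {S₁ T₁ S₂ T₂ S₃ T₃ : Set V}
    (h₁ : G.WalkIn S₁ a b) (k₁ : G.WalkIn T₁ c d) (h₂ : G.WalkIn S₂ a c) (k₂ : G.WalkIn T₂ b d)
    (h₃ : G.WalkIn S₃ a d) (k₃ : G.WalkIn T₃ b c) (e₁ : ∀ z ∈ S₁, z ∉ T₁)
    (e₂ : ∀ z ∈ S₂, z ∉ T₂) (e₃ : ∀ z ∈ S₃, z ∉ T₃) : False :=
  let ⟨p₁, hp₁⟩ := h₁
  let ⟨q₁, hq₁⟩ := k₁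
  let ⟨p₂, hp₂⟩ := h₂
  let ⟨q₂, hq₂⟩ := k₂
  let ⟨p₃, hp₃⟩ := h₃
  let ⟨q₃, hq₃⟩ := k₃
  hL a b c d p₁ q₁ p₂ q₂ p₃ q₃ (fun z h k => e₁ z (hp₁ z h) (hq₁ z k))
    (fun z h k => e₂ z (hp₂ z h) (hq₂ z k)) (fun z h k => e₃ z (hp₃ z h) (hq₃ z k))

/-! ### Distance layers, the layer graph and lobes -/

namespace SimpleGraph

variable {V : Type*} (G : SimpleGraph V)

/-- A chosen root in the connected component of a vertex. -/
noncomputable def compRoot (x : V) : V := Quot.out (G.connectedComponentMk x)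

/-- The distance of a vertex from the root of its component. -/
noncomputable def layer (x : V) : ℕ := G.dist (G.compRoot x) x

variable {G}

theorem compRoot_eq {x y : V} (h : G.Reachable x y) : G.compRoot x = G.compRoot y := by
  unfold compRoot
  rw [ConnectedComponent.sound h]

theorem reachable_compRoot (x : V) : G.Reachable (G.compRoot x) x :=
  ConnectedComponent.exact (Quot.out_eq (G.connectedComponentMk x))

theorem layer_le_of_adj {x y : V} (h : G.Adj x y) : G.layer y ≤ G.layer x + 1 := by
  obtain ⟨p, hp⟩ := (reachable_compRoot (G := G) x).exists_walk_length_eq_dist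
  unfold layer
  rw [← compRoot_eq h.reachable, ← hp]
  simpa using dist_le (p.concat h)

theorem exists_adj_layer_lt {x : V} (h : x ≠ G.compRoot x) :
    ∃ y, G.Adj x y ∧ G.layer y < G.layer x := by
  obtain ⟨p, hp⟩ := (reachable_compRoot (G := G) x).exists_walk_length_eq_dist
  have hl : p.reverse.length = G.layer x := by simpa [layer] using hp
  generalize p.reverse = r at hl
  revert h hl
  generalize hw : G.compRoot x = w at r
  intro h hl
  cases r with
  | nil => exact absurd rfl h
  | @cons _ y _ e q =>
    refine ⟨y, e, ?_⟩
    rw [← hl, Walk.length_cons]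
    subst hw
    unfold layer
    rw [← compRoot_eq e.reachable]
    have := dist_le q.reverse
    rw [Walk.length_reverse] at this
    omega

theorem walkIn_compRoot (x : V) :
    G.WalkIn {z | z = x ∨ G.layer z < G.layer x} x (G.compRoot x) := by
  induction h : G.layer x using Nat.strong_induction_on generalizing x with
  | _ n ih =>
    subst h
    by_cases hx : x = G.compRoot x
    · rw [← hx]
      exact .refl (Or.inl rfl)
    · obtain ⟨y, hy, hlt⟩ := exists_adj_layer_lt hx
      rw [compRoot_eq hy.reachable]
      refine (WalkIn.of_adj hy (Or.inl rfl) (Or.inr hlt)).trans ((ih _ hlt y rfl).mono ?_)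
      rintro z (rfl | hz)
      exacts [Or.inr hlt, Or.inr (hz.trans hlt)]

theorem walkIn_above {x y : V} (h : G.Reachable x y) (hl : G.layer x = G.layer y) :
    G.WalkIn {z | z = x ∨ z = y ∨ G.layer z < G.layer x} x y := by
  have hy := (walkIn_compRoot (G := G) y).symm
  rw [← compRoot_eq h] at hy
  refine ((walkIn_compRoot x).mono ?_).trans (hy.mono ?_)
  · rintro z (h | h)
    exacts [Or.inl h, Or.inr (Or.inr h)]
  · rintro z (h | h)
    exacts [Or.inr (Or.inl h), Or.inr (Or.inr (hl ▸ h))]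

variable (G)

/-- Two vertices of the same layer are adjacent in the layer graph if a walk joins them whose
inner vertices all lie in deeper layers. -/
def layerGraph : SimpleGraph V where
  Adj a b := a ≠ b ∧ G.layer a = G.layer b ∧
    G.WalkIn {z | z = a ∨ z = b ∨ G.layer a < G.layer z} a b
  symm := ⟨fun a b ⟨h, hl, hw⟩ => ⟨h.symm, hl.symm, hw.symm.mono fun z hz => by
    simp only [Set.mem_ofPred_eq] at hz ⊢
    rw [← hl]
    tauto⟩⟩
  loopless := ⟨fun a h => h.1 rfl⟩

/-- Two vertices of the same layer that are joined by a walk not going above that layer. -/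
def sameLobe : Setoid V where
  r x y := G.layer x = G.layer y ∧ G.WalkIn {z | G.layer x ≤ G.layer z} x y
  iseqv :=
    { refl := fun x => ⟨rfl, .refl (le_refl (G.layer x))⟩
      symm := fun {x y} ⟨h, hw⟩ => ⟨h.symm, hw.symm.mono fun z hz => by rwa [← h]⟩
      trans := fun {x y z} ⟨h, hw⟩ ⟨h', hw'⟩ =>
        ⟨h.trans h', hw.trans (hw'.mono fun z hz => by rwa [h])⟩ }

variable {G}

theorem layerGraph_adj_of_adj {a b : V} (h : G.Adj a b) (hl : G.layer a = G.layer b) :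
    G.layerGraph.Adj a b :=
  ⟨h.ne, hl, .of_adj h (Or.inl rfl) (Or.inr (Or.inl rfl))⟩

theorem sameLobe_of_layerGraph_adj {a b : V} (h : G.layerGraph.Adj a b) : G.sameLobe a b := by
  obtain ⟨-, hl, hw⟩ := h
  refine ⟨hl, hw.mono ?_⟩
  rintro z (rfl | rfl | hz)
  exacts [le_refl (G.layer z), hl.le, le_of_lt hz]

variable (G)

/-- `u` is in the layer just above `x` and is adjacent to `x`. -/
def IsParent (u x : V) : Prop := G.Adj u x ∧ G.layer u + 1 = G.layer x

variable {G}

theorem layerGraph_adj_of_isParent {x y u v : V} (hxy : G.sameLobe x y) (hu : G.IsParent u x)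
    (hv : G.IsParent v y) (huv : u ≠ v) : G.layerGraph.Adj u v := by
  obtain ⟨hl, hw⟩ := hxy
  obtain ⟨au, lu⟩ := hu
  obtain ⟨av, lv⟩ := hv
  refine ⟨huv, by omega, ?_⟩
  refine (WalkIn.of_adj au (Or.inl rfl) ?_).trans ((hw.mono ?_).trans
    (WalkIn.of_adj av.symm ?_ (Or.inr (Or.inl rfl))))
  · exact Or.inr (Or.inr (by omega))
  · intro z (hz : G.layer x ≤ G.layer z)
    exact Or.inr (Or.inr (by omega))
  · exact Or.inr (Or.inr (by omega))

end SimpleGraph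

/-! ### Structure of the layers forced by the linkage condition -/

namespace NoTripleLinkage

variable {V : Type*} {G : SimpleGraph V}

/-- The forbidden linkage is on `a`, `b`, `c` and the root: walks to the root use shallower layers,
and the walks among `a`, `b`, `c` never do. -/
theorem no_triangle (hL : NoTripleLinkage G) {a b c : V} (hab : G.layerGraph.Adj a b)
    (hac : G.layerGraph.Adj a c) (hbc : b ≠ c)
    (hw : G.WalkIn {z | z ≠ a ∧ G.layer a ≤ G.layer z} b c) : False := by
  obtain ⟨nab, lab, wab⟩ := hab
  obtain ⟨nac, lac, wac⟩ := hac
  have ub := walkIn_compRoot (G := G) b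
  have uc := walkIn_compRoot (G := G) c
  rw [← compRoot_eq wab.reachable] at ub
  rw [← compRoot_eq wac.reachable] at uc
  refine hL.elim wab uc wac ub (walkIn_compRoot a) hw ?_ ?_ ?_
  · rintro z (rfl | rfl | hz) (rfl | hz') <;> first | contradiction | omega
  · rintro z (rfl | rfl | hz) (rfl | hz') <;> first | contradiction | omega
  · rintro z (rfl | hz) ⟨h1, h2⟩
    · contradiction
    · omega

theorem walkIn_of_layerGraph_walk {x y a : V} (p : G.layerGraph.Walk x y)
    (hp : a ∉ p.support) (hl : G.layer x = G.layer a) :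
    G.WalkIn {z | z ≠ a ∧ G.layer a ≤ G.layer z} x y := by
  induction p with
  | nil => exact .refl ⟨fun h => hp (by simp [h]), hl.ge⟩
  | @cons u v w e p ih =>
    rw [Walk.support_cons, List.mem_cons, not_or] at hp
    obtain ⟨-, le, we⟩ := e
    refine (we.mono ?_).trans (ih hp.2 (le ▸ hl))
    rintro z (rfl | rfl | hz)
    · exact ⟨fun h => hp.1 h.symm, hl.ge⟩
    · exact ⟨fun h => hp.2 (h ▸ p.start_mem_support), (le ▸ hl).ge⟩
    · exact ⟨by rintro rfl; omega, by omega⟩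

theorem isAcyclic_layerGraph (hL : NoTripleLinkage G) : G.layerGraph.IsAcyclic := by
  intro a c hc
  cases c with
  | nil => exact hc.ne_nil rfl
  | @cons _ b _ hab p =>
    rw [Walk.cons_isCycle_iff] at hc
    obtain ⟨hp, he⟩ := hc
    have hp' := hp.reverse
    have he' : s(a, b) ∉ p.reverse.edges := by simpa using he
    generalize p.reverse = q at hp' he'
    cases q with
    | nil => exact hab.ne rfl
    | @cons _ c _ hac q =>
      rw [Walk.cons_isPath_iff] at hp'
      refine hL.no_triangle hac hab ?_ (walkIn_of_layerGraph_walk q hp'.2 hac.2.1.symm)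
      rintro rfl
      exact he' (by simp)

/-- For three such neighbours, each edge at `a` is disjoint from a walk through shallower layers
joining the other two. -/
theorem encard_same_layer_le (hL : NoTripleLinkage G) (a : V) :
    {b | G.Adj a b ∧ G.layer a = G.layer b}.encard ≤ 2 := by
  by_contra! h
  have h3 : (3 : ℕ∞) ≤ {b | G.Adj a b ∧ G.layer a = G.layer b}.encard :=
    Order.add_one_le_of_lt h
  obtain ⟨t, ht, h3⟩ := Set.exists_subset_encard_eq h3
  obtain ⟨b, c, d, hbc, hbd, hcd, rfl⟩ := Set.encard_eq_three.mp h3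
  obtain ⟨ab, lb⟩ := ht (by simp : b ∈ _)
  obtain ⟨ac, lc⟩ := ht (by simp : c ∈ _)
  obtain ⟨ad, ld⟩ := ht (by simp : d ∈ _)
  have e : ∀ x, G.Adj a x → G.WalkIn {z | z = a ∨ z = x} a x := fun x hx =>
    .of_adj hx (Or.inl rfl) (Or.inr rfl)
  have above : ∀ x y, G.Adj a x → G.Adj a y → G.layer a = G.layer x → G.layer a = G.layer y →
      G.WalkIn {z | z = x ∨ z = y ∨ G.layer z < G.layer x} x y := fun x y hx hy lx ly =>
    walkIn_above (hx.reachable.symm.trans hy.reachable) (lx.symm.trans ly)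
  have := ab.ne
  have := ac.ne
  have := ad.ne
  refine hL.elim (e b ab) (above c d ac ad lc ld) (e c ac) (above b d ab ad lb ld) (e d ad)
    (above b c ab ac lb lc) ?_ ?_ ?_ <;>
  · rintro z (rfl | rfl) (rfl | rfl | h) <;> first | contradiction | omega

/-- Three distinct parents of one lobe would form a triangle in the layer graph. -/
theorem parent_mem_pair (hL : NoTripleLinkage G) {x y z u v w : V} (hxy : G.sameLobe x y)
    (hxz : G.sameLobe x z) (hu : G.IsParent u x) (hv : G.IsParent v y) (hw : G.IsParent w z)
    (huv : u ≠ v) : w = u ∨ w = v := by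
  by_contra! h
  have h1 := layerGraph_adj_of_isParent hxy hu hv huv
  have h2 := layerGraph_adj_of_isParent hxz hu hw h.1.symm
  have h3 := layerGraph_adj_of_isParent (G.sameLobe.trans (G.sameLobe.symm hxy) hxz) hv hw
    h.2.symm
  refine hL.no_triangle h1 h2 h.2.symm (walkIn_of_layerGraph_walk (.cons h3 .nil) ?_ h1.2.1.symm)
  simp [huv, h.1.symm]

/-- Both vertices would have the same two parents `u`, `v`. The four edges give two pairings of `u`,
`v`, `x`, `y`; the third joins `u` to `v` from above and `x` to `y` inside the lobe. -/
theorem eq_of_two_parents (hL : NoTripleLinkage G) {x y u v u' v' : V} (hxy : G.sameLobe x y)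
    (hu : G.IsParent u x) (hv : G.IsParent v x) (huv : u ≠ v)
    (hu' : G.IsParent u' y) (hv' : G.IsParent v' y) (huv' : u' ≠ v') : x = y := by
  by_contra hne
  obtain ⟨uy, vy⟩ : G.IsParent u y ∧ G.IsParent v y := by
    rcases hL.parent_mem_pair (G.sameLobe.refl x) hxy hu hv hu' huv with rfl | rfl <;>
    rcases hL.parent_mem_pair (G.sameLobe.refl x) hxy hu hv hv' huv with rfl | rfl
    · exact absurd rfl huv'
    · exact ⟨hu', hv'⟩
    · exact ⟨hv', hu'⟩
    · exact absurd rfl huv'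
  have e : ∀ p q, G.IsParent p q → G.WalkIn {z | z = p ∨ z = q} p q := fun p q h =>
    .of_adj h.1 (Or.inl rfl) (Or.inr rfl)
  obtain ⟨hl, hw⟩ := hxy
  have h1 := hu.2
  have h2 := hv.2
  refine hL.elim
    (walkIn_above (hu.1.reachable.trans hv.1.reachable.symm) (by omega)) hw
    (e u x hu) (e v y vy) (e u y uy) (e v x hv) ?_ ?_ ?_
  · rintro z (rfl | rfl | hz) h <;> rw [Set.mem_ofPred_eq] at h <;> omega
  · rintro z (rfl | rfl) (rfl | rfl) <;> first | contradiction | omega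
  · rintro z (rfl | rfl) (rfl | rfl) <;> first | contradiction | omega

/-- A two-colouring of the layer graph in which vertices with two parents are marked. -/
theorem exists_marking (hL : NoTripleLinkage G) :
    ∃ κ : V → Prop, (∀ a b, G.layerGraph.Adj a b → (κ a ↔ ¬ κ b)) ∧
      ∀ x u v, G.IsParent u x → G.IsParent v x → ¬ κ x → u = v := by
  classical
  rcases isEmpty_or_nonempty V
  · exact ⟨fun _ => True, fun a => isEmptyElim a, fun a => isEmptyElim a⟩
  let C := hL.isAcyclic_layerGraph.coloringTwo
  let two : V → Prop := fun x => ∃ u v, G.IsParent u x ∧ G.IsParent v x ∧ u ≠ v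
  -- The two-parent vertex of the lobe, unique if it exists. Otherwise the choice is arbitrary and
  -- harmless.
  let base : Quotient G.sameLobe → V := fun q =>
    Classical.epsilon fun x => Quotient.mk _ x = q ∧ two x
  refine ⟨fun x => C x = C (base (Quotient.mk _ x)), fun a b hab => ?_, fun x u v hu hv hκ => ?_⟩
  · have h1 : (Quotient.mk G.sameLobe a) = Quotient.mk _ b :=
      Quotient.sound (sameLobe_of_layerGraph_adj hab)
    have h2 : C a ≠ C b := C.valid hab
    simp only [h1]
    omega
  · by_contra huv
    have hx : two x := ⟨u, v, hu, hv, huv⟩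
    obtain ⟨h1, u', v', hu', hv', huv'⟩ := Classical.epsilon_spec
      (p := fun y => Quotient.mk G.sameLobe y = Quotient.mk _ x ∧ two y) ⟨x, rfl, hx⟩
    have := hL.eq_of_two_parents (Quotient.exact h1) hu' hv' huv' hu hv huv
    exact hκ (congrArg C this).symm

/-- Two parents have consecutive colours on the 5-cycle, and the colour opposite them is at distance
2 from both. -/
theorem exists_lobe_colour (hL : NoTripleLinkage G) {f : V → ZMod 5} (x : V)
    (hf : ∀ u v, G.layer u + 1 = G.layer x → G.layerGraph.Adj u v →
      f u - f v = 1 ∨ f u - f v = -1) :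
    ∃ m : ZMod 5, ∀ y u, G.sameLobe x y → G.IsParent u y → m - f u = 2 ∨ m - f u = 3 := by
  by_cases h0 : ∃ y u, G.sameLobe x y ∧ G.IsParent u y
  swap
  · exact ⟨0, fun y u h h' => (h0 ⟨y, u, h, h'⟩).elim⟩
  obtain ⟨y, u, hxy, hu⟩ := h0
  by_cases h1 : ∃ z v, G.sameLobe x z ∧ G.IsParent v z ∧ u ≠ v
  · obtain ⟨z, v, hxz, hv, huv⟩ := h1
    have hyz := G.sameLobe.trans (G.sameLobe.symm hxy) hxz
    have key : ∀ i j : ZMod 5, (i - j = 1 ∨ i - j = -1) →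
        ∃ m, (m - i = 2 ∨ m - i = 3) ∧ (m - j = 2 ∨ m - j = 3) := by decide
    obtain ⟨m, hm, hm'⟩ := key _ _ (hf u v (hu.2.trans hxy.1.symm)
      (layerGraph_adj_of_isParent hyz hu hv huv))
    refine ⟨m, fun w t hxw ht => ?_⟩
    rcases hL.parent_mem_pair hyz (G.sameLobe.trans (G.sameLobe.symm hxy) hxw) hu hv ht huv
      with rfl | rfl
    exacts [hm, hm']
  · push Not at h1
    refine ⟨f u + 2, fun z v hxz hv => Or.inl ?_⟩
    rw [← h1 z v hxz hv]
    ring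

theorem exists_colouring_below (hL : NoTripleLinkage G) (n : ℕ) : ∃ f : V → ZMod 5,
    (∀ a b, G.layer a < n → G.layerGraph.Adj a b → f a - f b = 1 ∨ f a - f b = -1) ∧
    ∀ u x, G.layer x < n → G.IsParent u x → f x - f u = 2 ∨ f x - f u = 3 := by
  classical
  rcases isEmpty_or_nonempty V
  · exact ⟨fun _ => 0, fun a => isEmptyElim a, fun a => isEmptyElim a⟩
  induction n with
  | zero => exact ⟨fun _ => 0, by simp, by simp⟩
  | succ n ih =>
    obtain ⟨f, hf, hf'⟩ := ih
    obtain ⟨κ, hκ, hκ'⟩ := hL.exists_marking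
    have hm : ∀ q : Quotient G.sameLobe, ∃ m : ZMod 5, G.layer q.out = n →
        ∀ y u, G.sameLobe q.out y → G.IsParent u y → m - f u = 2 ∨ m - f u = 3 := fun q => by
      by_cases hq : G.layer q.out = n
      · obtain ⟨m, hm⟩ := hL.exists_lobe_colour q.out
          (fun u v hu huv => hf u v (by omega) huv)
        exact ⟨m, fun _ => hm⟩
      · exact ⟨0, fun h => absurd h hq⟩
    choose m hm using hm
    have hm' : ∀ x u, G.layer x = n → G.IsParent u x →
        m (Quotient.mk _ x) - f u = 2 ∨ m (Quotient.mk _ x) - f u = 3 := fun x u hx hu => by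
      have h : G.sameLobe (Quotient.mk G.sameLobe x).out x := Quotient.mk_out x
      exact hm _ (h.1.trans hx) x u h hu
    have hpar : ∀ x, 0 < G.layer x → ∃ u, G.IsParent u x := fun x hx => by
      have hne : x ≠ G.compRoot x := fun h => by
        have h0 : G.layer x = G.dist (G.compRoot x) x := rfl
        rw [← h, dist_self] at h0
        omega
      obtain ⟨y, hy, hlt⟩ := exists_adj_layer_lt hne
      have := layer_le_of_adj hy.symm
      exact ⟨y, hy.symm, by omega⟩
    let par : V → V := fun x => Classical.epsilon fun u => G.IsParent u x
    have hparx : ∀ x u, G.IsParent u x → G.IsParent (par x) x := fun x u hu =>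
      Classical.epsilon_spec (p := fun u => G.IsParent u x) ⟨u, hu⟩
    -- The colours at distance 2 from $j$ are $j+2$ and $j+3$; they are consecutive, and $i\mapsto
    -- 2j-i$ exchanges them.
    let g : V → ZMod 5 := fun x =>
      if G.layer x = n then
        if κ x then m (Quotient.mk _ x) else 2 * f (par x) - m (Quotient.mk _ x)
      else f x
    have g1 : ∀ x, G.layer x < n → g x = f x := fun x hx => if_neg hx.ne
    have g2 : ∀ x, G.layer x = n → κ x → g x = m (Quotient.mk _ x) := fun x hx hk => by
      simp [g, hx, hk]
    have g3 : ∀ x, G.layer x = n → ¬ κ x → g x = 2 * f (par x) - m (Quotient.mk _ x) :=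
      fun x hx hk => by simp [g, hx, hk]
    have c1 : ∀ i j : ZMod 5, (i - j = 2 ∨ i - j = 3) →
        (i - (2 * j - i) = 1 ∨ i - (2 * j - i) = -1) := by decide
    have c2 : ∀ i j : ZMod 5, (i - j = 1 ∨ i - j = -1) → (j - i = 1 ∨ j - i = -1) := by decide
    have c3 : ∀ i j : ZMod 5, (i - j = 2 ∨ i - j = 3) →
        (2 * j - i - j = 2 ∨ 2 * j - i - j = 3) := by decide
    have side : ∀ a b, G.layer a = n → G.layerGraph.Adj a b → κ a →
        g a - g b = 1 ∨ g a - g b = -1 := fun a b ha hab hk => by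
      have hb : G.layer b = n := hab.2.1.symm.trans ha
      have hq : (Quotient.mk G.sameLobe a) = Quotient.mk _ b :=
        Quotient.sound (sameLobe_of_layerGraph_adj hab)
      rw [g2 a ha hk, g3 b hb ((hκ a b hab).mp hk), hq]
      -- Layer 0 has one vertex per component, hence no layer-graph edges; so `par b` is a genuine
      -- parent.
      have hpos : 0 < G.layer b := by
        by_contra h0
        have hr : ∀ x, G.layer x = 0 → G.compRoot x = x := fun x hx =>
          (reachable_compRoot x).dist_eq_zero_iff.mp hx
        refine hab.ne ?_
        rw [← hr a (by omega), ← hr b (by omega), compRoot_eq hab.2.2.reachable]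
      obtain ⟨u, hu⟩ := hpar b hpos
      exact c1 _ _ (hm' b _ hb (hparx b u hu))
    refine ⟨g, fun a b ha hab => ?_, fun u x hx hu => ?_⟩
    · rcases Nat.lt_succ_iff_lt_or_eq.mp ha with ha | ha
      · rw [g1 a ha, g1 b (hab.2.1 ▸ ha)]
        exact hf a b ha hab
      · by_cases hk : κ a
        · exact side a b ha hab hk
        · exact c2 _ _ (side b a (hab.2.1.symm.trans ha) hab.symm
            ((hκ b a hab.symm).mpr hk))
    · have hul := hu.2
      rw [g1 u (by omega)]
      rcases Nat.lt_succ_iff_lt_or_eq.mp hx with hx | hx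
      · rw [g1 x hx]
        exact hf' u x hx hu
      · by_cases hk : κ x
        · rw [g2 x hx hk]
          exact hm' x u hx hu
        · rw [g3 x hx hk, hκ' x (par x) u (hparx x u hu) hu hk]
          exact c3 _ _ (hm' x u hx hu)

theorem isRelaxedCircularColorable [Finite V] (hL : NoTripleLinkage G) :
    IsRelaxedCircularColorable G 5 2 2 := by
  obtain ⟨N, hN⟩ := (Set.finite_range G.layer).bddAbove
  obtain ⟨f, hf, hf'⟩ := hL.exists_colouring_below (N + 1)
  have hlt : ∀ x, G.layer x < N + 1 := fun x => Nat.lt_succ_of_le (hN ⟨x, rfl⟩)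
  have near : ∀ i j : ZMod 5, (i - j = 1 ∨ i - j = -1) → i ≠ j := by decide
  have far : ∀ i j : ZMod 5, (i - j = 2 ∨ i - j = 3) →
      2 ≤ circDist (k := 5) i j ∧ 2 ≤ circDist (k := 5) j i := by
    unfold circDist Nat.dist
    decide
  have self : ∀ i j : ZMod 5, 2 ≤ circDist (k := 5) i j → i ≠ j := by
    unfold circDist Nat.dist
    decide
  have cross : ∀ u v, G.Adj u v → G.layer u ≠ G.layer v → 2 ≤ circDist (k := 5) (f u) (f v) := by
    intro u v h hne
    have h1 := layer_le_of_adj h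
    have h2 := layer_le_of_adj h.symm
    rcases lt_or_gt_of_ne hne with hl | hl
    · exact (far _ _ (hf' u v (hlt v) ⟨h, by omega⟩)).2
    · exact (far _ _ (hf' v u (hlt u) ⟨h.symm, by omega⟩)).1
  refine ⟨f, fun u v h => ?_, fun u => ?_⟩
  · by_cases hl : G.layer u = G.layer v
    · exact near _ _ (hf u v (hlt u) (layerGraph_adj_of_adj h hl))
    · exact self _ _ (cross u v h hl)
  · refine (Set.encard_le_encard fun v hv => ?_).trans (hL.encard_same_layer_le u)
    refine ⟨hv.1, ?_⟩
    by_contra hl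
    exact (cross u v hv.1 hl).not_gt hv.2

end NoTripleLinkage

theorem IsRelaxedCircularColorable.mono {V : Type*} {G : SimpleGraph V} {k q s t : ℕ}
    (h : IsRelaxedCircularColorable G k q s) (hst : s ≤ t) : IsRelaxedCircularColorable G k q t :=
  let ⟨f, hf, hf'⟩ := h
  ⟨f, hf, fun u => (hf' u).trans (by exact_mod_cast hst)⟩

theorem mainTheorem1 {V : Type*} [Finite V] (G : SimpleGraph V) (hG : IsOuterplanar G) :
    IsRelaxedCircularColorable G 5 2 4 :=
  hG.noTripleLinkage.isRelaxedCircularColorable.mono (by norm_num)
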